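/- Assume the Riemann Hypothesis. Let $\zeta$ be the Riemann zeta function and, for $0<\varepsilon\le 1/2$, consider the meromorphic function $s\mapsto \zeta(s)/\zeta(s+\varepsilon)$ (which vanishes at $s=1-\varepsilon$, where $\zeta(s+\varepsilon)$ has its pole). There are absolute constants $C_1,C_2,C_3>0$ such that for every $\varepsilon$ with $0<\varepsilon\le 1/2$: (i) for all $s\in\mathbb{C}$ with $\Re s=1/2$, $$\left|\frac{\zeta(s)}{\zeta(s+\varepsilon)}\right|^2\le C_1\,|s|^{\varepsilon};$$ (ii) for all $s\in\mathbb{C}$ with $\Re s=1/2$, $$\left|\frac{\zeta(s)}{\zeta(s+\varepsilon)}\right|^2\le 1+C_2\,\varepsilon\,|s|^{1/2};$$ (iii) for all $s\in\mathbb{C}$ with $\Re s\ge 1/2$ and $s\ne 1$, $$\left|\frac{\zeta(s)/\zeta(s+\varepsilon)}{s(1-s)}\right|\le C_3\,\frac{|s|^{\varepsilon/2}}{|s-1|^2}.$$ -/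

import Mathlib

/-- The value at `s` of the meromorphic function `s ↦ ζ(s) / ζ(s + ε)`. At `s = 1 - ε` the
denominator has its pole, so the quotient takes the value `0` there (for `ε ≠ 0`); this has to be
said separately because `riemannZeta 1` is a finite default value. -/
noncomputable def zetaQuotient (ε : ℝ) (s : ℂ) : ℂ :=
  if s + (ε : ℂ) = 1 then 0 else riemannZeta s / riemannZeta (s + (ε : ℂ))

open Filter Topology

/-- Logarithmic concavity of `x ↦ ‖w + x‖` on `[0, 1]`, up to an error. -/
lemma norm_mul_norm_add_one_rpow_le {w : ℂ} {δ c : ℝ} (hδ : 0 ≤ δ) (hδ1 : δ ≤ 1) (hc : 0 < c)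
    (hw : c ≤ w.re) :
    ‖w‖ * ‖w + 1‖ ^ δ ≤ ‖w + δ‖ * ‖w‖ ^ δ * Real.exp (δ * (1 / c ^ 2)) := by
  have hw0 : 0 < ‖w‖ := lt_of_lt_of_le (hc.trans_le hw) (Complex.re_le_norm w)
  have hre : c ≤ (w + δ).re := by simp; linarith
  have hwδ : c ≤ ‖w + δ‖ := hre.trans (Complex.re_le_norm _)
  have e1 : ‖w + 1‖ ^ 2 = ‖w‖ ^ 2 + 2 * w.re + 1 := by
    rw [Complex.sq_norm, Complex.sq_norm, Complex.normSq_apply, Complex.normSq_apply]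
    simp; ring
  have e2 : ‖w + δ‖ ^ 2 = ‖w‖ ^ 2 + 2 * δ * w.re + δ ^ 2 := by
    rw [Complex.sq_norm, Complex.sq_norm, Complex.normSq_apply, Complex.normSq_apply]
    simp; ring
  have amgm := Real.geom_mean_le_arith_mean2_weighted (w₁ := 1 - δ) (w₂ := δ)
    (p₁ := ‖w‖ ^ 2) (p₂ := ‖w + 1‖ ^ 2) (by linarith) hδ (by positivity) (by positivity) (by ring)
  have hexp : 1 + δ * (1 / c ^ 2) ≤ Real.exp (δ * (1 / c ^ 2)) := by
    linarith [Real.add_one_le_exp (δ * (1 / c ^ 2))]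
  have hcc : 1 ≤ 1 / c ^ 2 * ‖w + δ‖ ^ 2 := by
    rw [one_div, inv_mul_eq_div, one_le_div (by positivity)]
    gcongr
  have key : (‖w‖ ^ 2) ^ (1 - δ) * (‖w + 1‖ ^ 2) ^ δ
      ≤ ‖w + δ‖ ^ 2 * Real.exp (δ * (1 / c ^ 2)) := by
    calc _ ≤ (1 - δ) * ‖w‖ ^ 2 + δ * ‖w + 1‖ ^ 2 := amgm
      _ ≤ ‖w + δ‖ ^ 2 * (1 + δ * (1 / c ^ 2)) := by
        have := mul_le_mul_of_nonneg_left hcc hδ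
        nlinarith
      _ ≤ _ := by gcongr
  have h1 : (‖w‖ ^ 2) ^ (1 - δ) * (‖w‖ ^ δ) ^ 2 = ‖w‖ ^ 2 := by
    rw [← Real.rpow_natCast (‖w‖ ^ δ) 2, ← Real.rpow_mul hw0.le, ← Real.rpow_natCast ‖w‖ 2,
      ← Real.rpow_mul hw0.le, ← Real.rpow_add hw0]
    congr 1; push_cast; ring
  have h2 : (‖w + 1‖ ^ 2) ^ δ = (‖w + 1‖ ^ δ) ^ 2 := by
    rw [← Real.rpow_natCast (‖w + 1‖ ^ δ) 2, ← Real.rpow_mul (norm_nonneg _),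
      ← Real.rpow_natCast ‖w + 1‖ 2, ← Real.rpow_mul (norm_nonneg _), mul_comm]
  refine le_of_sq_le_sq ?_ (by positivity)
  have hE : 1 ≤ Real.exp (δ * (1 / c ^ 2)) := Real.one_le_exp (by positivity)
  calc (‖w‖ * ‖w + 1‖ ^ δ) ^ 2
      = ((‖w‖ ^ 2) ^ (1 - δ) * (‖w + 1‖ ^ 2) ^ δ) * (‖w‖ ^ δ) ^ 2 := by
        rw [mul_pow, h2]; linear_combination -(‖w + 1‖ ^ δ) ^ 2 * h1
    _ ≤ (‖w + δ‖ ^ 2 * Real.exp (δ * (1 / c ^ 2))) * (‖w‖ ^ δ) ^ 2 := by gcongr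
    _ ≤ (‖w + δ‖ ^ 2 * Real.exp (δ * (1 / c ^ 2)) ^ 2) * (‖w‖ ^ δ) ^ 2 := by
        gcongr
        nlinarith
    _ = _ := by ring

lemma norm_prod_mul_rpow_le {z : ℂ} {δ a : ℝ} (hδ : 0 ≤ δ) (hδ1 : δ ≤ 1) (ha : 0 < a)
    (hz : a ≤ z.re) (m : ℕ) :
    ‖∏ j ∈ Finset.range m, (z + j)‖ * ‖z + m‖ ^ δ ≤ ‖∏ j ∈ Finset.range m, (z + δ + j)‖ *
      ‖z‖ ^ δ * Real.exp (δ * ∑ j ∈ Finset.range m, 1 / (a + j) ^ 2) := by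
  induction m with
  | zero => simp
  | succ m ih =>
    have h := norm_mul_norm_add_one_rpow_le (w := z + m) (c := a + m) hδ hδ1 (by positivity)
      (by simpa using hz)
    rw [Finset.prod_range_succ, Finset.prod_range_succ, Finset.sum_range_succ, norm_mul, norm_mul,
      mul_add, Real.exp_add]
    have e : z + (m : ℂ) + δ = z + δ + m := by ring
    rw [e] at h
    push_cast
    rw [← add_assoc]
    calc _ = ‖∏ j ∈ Finset.range m, (z + j)‖ * (‖z + m‖ * ‖z + m + 1‖ ^ δ) := by ring
      _ ≤ ‖∏ j ∈ Finset.range m, (z + j)‖ * (‖z + δ + m‖ * ‖z + m‖ ^ δ *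
          Real.exp (δ * (1 / (a + m) ^ 2))) := by gcongr
      _ = (‖∏ j ∈ Finset.range m, (z + j)‖ * ‖z + m‖ ^ δ) * (‖z + δ + m‖ *
          Real.exp (δ * (1 / (a + m) ^ 2))) := by ring
      _ ≤ _ := (mul_le_mul_of_nonneg_right ih (by positivity)).trans_eq (by ring)

lemma summable_one_div_add_nat_sq {a : ℝ} (ha : 0 < a) :
    Summable fun j : ℕ ↦ 1 / (a + j) ^ 2 := by
  rw [← summable_nat_add_iff 1]
  refine Summable.of_nonneg_of_le (fun j ↦ by positivity) (fun j ↦ ?_)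
    ((summable_nat_add_iff 1).2 (Real.summable_one_div_nat_pow.2 one_lt_two))
  gcongr
  linarith

lemma norm_prod_add_nat_pos {w : ℂ} (hw : 0 < w.re) (m : ℕ) :
    0 < ‖∏ j ∈ Finset.range m, (w + j)‖ := by
  rw [norm_pos_iff, Finset.prod_ne_zero_iff]
  intro j _ h
  have := congrArg Complex.re h
  simp at this
  linarith [(Nat.cast_nonneg j : (0 : ℝ) ≤ j)]

/-- Upper bound for a ratio of Gamma values, with the correct order of growth. -/
theorem norm_Gamma_add_le {a : ℝ} (ha : 0 < a) :
    ∃ K : ℝ, 0 < K ∧ ∀ (z : ℂ) (δ : ℝ), 0 ≤ δ → δ ≤ 1 → a ≤ z.re →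
      ‖Complex.Gamma (z + δ)‖ ≤ (K * ‖z‖) ^ δ * ‖Complex.Gamma z‖ := by
  set S := ∑' j : ℕ, 1 / (a + j) ^ 2 with hS
  refine ⟨Real.exp S, Real.exp_pos _, fun z δ hδ hδ1 hz ↦ ?_⟩
  refine le_of_tendsto_of_tendsto (Complex.GammaSeq_tendsto_Gamma (z + δ)).norm
    ((Complex.GammaSeq_tendsto_Gamma z).norm.const_mul _) ?_
  filter_upwards [eventually_gt_atTop 0] with n hn
  have hn' : (0 : ℝ) < n := by exact_mod_cast hn
  have h := norm_prod_mul_rpow_le hδ hδ1 ha hz (n + 1)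
  have hP := norm_prod_add_nat_pos (w := z) (by linarith) (n + 1)
  have hQ := norm_prod_add_nat_pos (w := z + δ) (by simp; linarith) (n + 1)
  have hn0 : (n : ℂ) ≠ 0 := by exact_mod_cast hn.ne'
  have hsum : ∑ j ∈ Finset.range (n + 1), 1 / (a + j) ^ 2 ≤ S :=
    (summable_one_div_add_nat_sq ha).sum_le_tsum _ fun j _ ↦ by positivity
  have hnz : (n : ℝ) ≤ ‖z + (n + 1 : ℕ)‖ := by
    refine le_trans ?_ (Complex.re_le_norm _)
    simp; linarith
  have hnδ : ‖((n : ℂ) ^ (δ : ℂ))‖ = (n : ℝ) ^ δ := by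
    rw [← Complex.ofReal_natCast, Complex.norm_cpow_eq_rpow_re_of_pos hn', Complex.ofReal_re]
  simp only [Complex.GammaSeq, norm_div, norm_mul]
  rw [Complex.cpow_add _ _ hn0, norm_mul, hnδ, div_le_iff₀ hQ, mul_div_assoc', div_mul_eq_mul_div,
    le_div_iff₀ hP, Real.mul_rpow (Real.exp_pos _).le (norm_nonneg _), ← Real.exp_mul]
  have h' : ‖∏ j ∈ Finset.range (n + 1), (z + j)‖ * (n : ℝ) ^ δ ≤
      ‖∏ j ∈ Finset.range (n + 1), (z + δ + j)‖ * ‖z‖ ^ δ * Real.exp (S * δ) := by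
    refine le_trans ?_ (h.trans ?_)
    · gcongr
    · rw [mul_comm S]
      gcongr
  calc _ = ‖(n : ℂ) ^ z‖ * ‖(n.factorial : ℂ)‖ *
        (‖∏ j ∈ Finset.range (n + 1), (z + j)‖ * (n : ℝ) ^ δ) := by ring
    _ ≤ _ := mul_le_mul_of_nonneg_left h' (by positivity)
    _ = _ := by ring

/-- `‖Γ(z) / Γ(z + δ)‖` is largest on the real axis. -/
theorem norm_Gamma_mul_Gamma_add_le {a δ : ℝ} (ha : 0 < a) (hδ : 0 ≤ δ) {z : ℂ} (hz : a ≤ z.re) :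
    ‖Complex.Gamma z‖ * Real.Gamma (a + δ) ≤ ‖Complex.Gamma (z + δ)‖ * Real.Gamma a := by
  refine le_of_tendsto_of_tendsto
    ((Complex.GammaSeq_tendsto_Gamma z).norm.mul (Real.GammaSeq_tendsto_Gamma (a + δ)))
    ((Complex.GammaSeq_tendsto_Gamma (z + δ)).norm.mul (Real.GammaSeq_tendsto_Gamma a)) ?_
  filter_upwards [eventually_gt_atTop 0] with n hn
  have hn' : (0 : ℝ) < n := by exact_mod_cast hn
  have hP := norm_prod_add_nat_pos (w := z) (by linarith) (n + 1)
  have hQ := norm_prod_add_nat_pos (w := z + δ) (by simp; linarith) (n + 1)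
  have hn0 : (n : ℂ) ≠ 0 := by exact_mod_cast hn.ne'
  have hnδ : ‖((n : ℂ) ^ (δ : ℂ))‖ = (n : ℝ) ^ δ := by
    rw [← Complex.ofReal_natCast, Complex.norm_cpow_eq_rpow_re_of_pos hn', Complex.ofReal_re]
  have hA : 0 < ∏ j ∈ Finset.range (n + 1), (a + (j : ℝ)) :=
    Finset.prod_pos fun j _ ↦ by positivity
  have hB : 0 < ∏ j ∈ Finset.range (n + 1), (a + δ + (j : ℝ)) :=
    Finset.prod_pos fun j _ ↦ by positivity
  have key : ‖∏ j ∈ Finset.range (n + 1), (z + δ + j)‖ * ∏ j ∈ Finset.range (n + 1), (a + (j : ℝ))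
      ≤ ‖∏ j ∈ Finset.range (n + 1), (z + j)‖ * ∏ j ∈ Finset.range (n + 1), (a + δ + (j : ℝ)) := by
    rw [norm_prod, norm_prod, ← Finset.prod_mul_distrib, ← Finset.prod_mul_distrib]
    refine Finset.prod_le_prod (fun j _ ↦ by positivity) fun j _ ↦ ?_
    have h1 : ‖z + δ + j‖ ≤ ‖z + j‖ + δ := by
      have : z + δ + j = (z + j) + (δ : ℂ) := by ring
      rw [this]
      refine (norm_add_le _ _).trans ?_
      rw [Complex.norm_real, Real.norm_of_nonneg hδ]
    have h2 : a + j ≤ ‖z + j‖ := by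
      refine le_trans ?_ (Complex.re_le_norm _)
      simpa using hz
    have h3 : 0 < a + (j : ℝ) := by positivity
    nlinarith [mul_le_mul_of_nonneg_right h1 h3.le, mul_le_mul_of_nonneg_left h2 hδ]
  simp only [Complex.GammaSeq, Real.GammaSeq, norm_div, norm_mul]
  rw [Complex.cpow_add _ _ hn0, norm_mul, hnδ, Real.rpow_add hn', div_mul_div_comm,
    div_mul_div_comm, div_le_div_iff₀ (by positivity) (by positivity)]
  calc _ = ‖(n : ℂ) ^ z‖ * ‖(n.factorial : ℂ)‖ * ((n : ℝ) ^ a * (n : ℝ) ^ δ * n.factorial) *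
      (‖∏ j ∈ Finset.range (n + 1), (z + δ + j)‖ * ∏ j ∈ Finset.range (n + 1), (a + (j : ℝ))) := by
        ring
    _ ≤ _ := mul_le_mul_of_nonneg_left key (by positivity)
    _ = _ := by ring

/-- The terms of the expansion of `(s - 1) ζ(s) - 1` that converges for `0 < re s`. -/
noncomputable def zetaOneTerm (n : ℕ) (s : ℂ) : ℂ :=
  (s - 1) * (n + 1 : ℂ) ^ (-s) - (n + 1 : ℂ) ^ (1 - s) + (n + 2 : ℂ) ^ (1 - s)

lemma differentiable_zetaOneTerm (n : ℕ) : Differentiable ℂ (zetaOneTerm n) := by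
  have h1 : (n + 1 : ℂ) ≠ 0 := by exact_mod_cast n.succ_ne_zero
  have h2 : (n + 2 : ℂ) ≠ 0 := by exact_mod_cast (n + 1).succ_ne_zero
  intro s
  unfold zetaOneTerm
  refine DifferentiableAt.add (DifferentiableAt.sub (DifferentiableAt.mul (by fun_prop) ?_) ?_) ?_
  · exact DifferentiableAt.const_cpow (by fun_prop) (Or.inl h1)
  · exact DifferentiableAt.const_cpow (by fun_prop) (Or.inl h1)
  · exact DifferentiableAt.const_cpow (by fun_prop) (Or.inl h2)

lemma norm_zetaOneTerm_le (n : ℕ) {s : ℂ} {a : ℝ} (ha : 0 ≤ a) (hs : a ≤ s.re) :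
    ‖zetaOneTerm n s‖ ≤ ‖s - 1‖ * ‖s‖ * (1 / ((n : ℝ) + 1) ^ (a + 1)) := by
  set N : ℝ := n + 1 with hN
  have hN1 : 1 ≤ N := by rw [hN]; linarith [(Nat.cast_nonneg n : (0 : ℝ) ≤ n)]
  have hderiv : ∀ (r : ℂ) (x : ℝ), x ∈ Set.Icc N (N + 1) →
      HasDerivWithinAt (fun y : ℝ ↦ (y : ℂ) ^ r) (r * (x : ℂ) ^ (r - 1)) (Set.Icc N (N + 1)) x := by
    intro r x hx
    have hx0 : 0 < x := by linarith [hx.1]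
    by_cases hr : r = 0
    · subst hr
      simpa using hasDerivWithinAt_const x (Set.Icc N (N + 1)) (1 : ℂ)
    exact (hasDerivAt_ofReal_cpow_const hx0.ne' hr).hasDerivWithinAt
  have hb : ∀ x ∈ Set.Icc N (N + 1), ‖(-s) * (x : ℂ) ^ (-s - 1)‖ ≤ ‖s‖ * (1 / N ^ (a + 1)) := by
    intro x hx
    have hx0 : 0 < x := by linarith [hx.1]
    rw [norm_mul, norm_neg, Complex.norm_cpow_eq_rpow_re_of_pos hx0, one_div,
      ← Real.rpow_neg (by linarith)]
    gcongr
    calc x ^ (-s - 1).re ≤ x ^ (-(a + 1)) := by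
          apply Real.rpow_le_rpow_of_exponent_le (by linarith [hx.1])
          simp; linarith
      _ ≤ _ := Real.rpow_le_rpow_of_nonpos (by linarith) hx.1 (by linarith)
  have hNm : N ∈ Set.Icc N (N + 1) := ⟨le_rfl, by linarith⟩
  have hNm' : N + 1 ∈ Set.Icc N (N + 1) := ⟨by linarith, le_rfl⟩
  have step : ∀ x ∈ Set.Icc N (N + 1),
      ‖(x : ℂ) ^ (-s) - (N : ℂ) ^ (-s)‖ ≤ ‖s‖ * (1 / N ^ (a + 1)) := by
    intro x hx
    have := (convex_Icc N (N + 1)).norm_image_sub_le_of_norm_hasDerivWithin_le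
      (hderiv (-s)) hb hNm hx
    refine this.trans (mul_le_of_le_one_right (by positivity) ?_)
    rw [Real.norm_of_nonneg (by linarith [hx.1])]
    linarith [hx.2]
  have h2 := (convex_Icc N (N + 1)).norm_image_sub_le_of_norm_hasDerivWithin_le
      (f := fun x : ℝ ↦ (x : ℂ) ^ (1 - s) - ((1 - s) * (N : ℂ) ^ (-s)) * (x : ℂ))
      (f' := fun x : ℝ ↦ (1 - s) * (x : ℂ) ^ ((1 - s) - 1) - ((1 - s) * (N : ℂ) ^ (-s)) * 1)
      (C := ‖s - 1‖ * (‖s‖ * (1 / N ^ (a + 1))))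
      (fun x hx ↦ (hderiv (1 - s) x hx).sub
        ((Complex.ofRealCLM.hasDerivAt (x := x)).hasDerivWithinAt.const_mul _))
      (fun x hx ↦ by
        have e : (1 - s) * (x : ℂ) ^ ((1 - s) - 1) - ((1 - s) * (N : ℂ) ^ (-s)) * 1
          = (1 - s) * ((x : ℂ) ^ (-s) - (N : ℂ) ^ (-s)) := by
            rw [show (1 - s) - 1 = -s by ring]; ring
        rw [e, norm_mul, norm_sub_rev 1 s]
        gcongr
        exact step x hx) hNm hNm'
  have e : zetaOneTerm n s = ((N + 1 : ℝ) : ℂ) ^ (1 - s) -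
      ((1 - s) * (N : ℂ) ^ (-s)) * ((N + 1 : ℝ) : ℂ) -
      ((N : ℂ) ^ (1 - s) - ((1 - s) * (N : ℂ) ^ (-s)) * (N : ℂ)) := by
    have hNc : (N : ℂ) = n + 1 := by rw [hN]; push_cast; rfl
    unfold zetaOneTerm
    push_cast
    rw [hNc, show (n : ℂ) + 1 + 1 = n + 2 by ring]
    ring
  rw [e]
  refine h2.trans_eq ?_
  simp [mul_assoc]

lemma summable_one_div_add_one_rpow {a : ℝ} (ha : 0 < a) :
    Summable fun n : ℕ ↦ 1 / ((n : ℝ) + 1) ^ (a + 1) := by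
  have := (summable_nat_add_iff 1).2 (Real.summable_one_div_nat_rpow.2 (lt_add_of_pos_left 1 ha))
  simpa using this

lemma sum_range_zetaOneTerm (s : ℂ) (N : ℕ) : ∑ n ∈ Finset.range N, zetaOneTerm n s =
    (s - 1) * ∑ n ∈ Finset.range N, 1 / (n + 1 : ℂ) ^ s + (N + 1 : ℂ) ^ (1 - s) - 1 := by
  induction N with
  | zero => simp
  | succ N ih =>
    rw [Finset.sum_range_succ, Finset.sum_range_succ, ih, zetaOneTerm, Complex.cpow_neg]
    push_cast
    rw [show (N : ℂ) + 1 + 1 = N + 2 by ring]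
    ring

lemma hasSum_zetaOneTerm {s : ℂ} (hs : 1 < s.re) :
    HasSum (fun n ↦ zetaOneTerm n s) (riemannZeta₁ s - 1) := by
  have hs1 : s ≠ 1 := by rintro rfl; simp at hs
  have hsum : Summable fun n ↦ zetaOneTerm n s :=
    .of_norm_bounded ((summable_one_div_add_one_rpow one_pos).mul_left _)
      fun n ↦ norm_zetaOneTerm_le n zero_le_one hs.le
  have hsum' : Summable fun n : ℕ ↦ 1 / (n + 1 : ℂ) ^ s := by
    have := (summable_nat_add_iff 1).2 (Complex.summable_one_div_nat_cpow.2 hs)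
    simpa using this
  rw [hsum.hasSum_iff_tendsto_nat]
  simp_rw [sum_range_zetaOneTerm]
  have e : riemannZeta₁ s - 1 = (s - 1) * riemannZeta s + 0 - 1 := by
    rw [riemannZeta_eq_inv_sub_mul hs1]
    field_simp [sub_ne_zero.2 hs1]
    ring
  rw [e, zeta_eq_tsum_one_div_nat_add_one_cpow hs]
  refine ((hsum'.hasSum.tendsto_sum_nat.const_mul _).add ?_).sub_const _
  rw [tendsto_zero_iff_norm_tendsto_zero]
  have h0 : Tendsto (fun N : ℕ ↦ ((N : ℝ) + 1) ^ (-(s.re - 1))) atTop (𝓝 0) :=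
    (tendsto_rpow_neg_atTop (by linarith)).comp
      (tendsto_atTop_add_const_right _ _ tendsto_natCast_atTop_atTop)
  refine h0.congr fun N ↦ ?_
  have := Complex.norm_cpow_eq_rpow_re_of_pos (x := (N : ℝ) + 1) (by positivity) (1 - s)
  push_cast at this
  rw [this]
  simp

lemma riemannZeta₁_eq_one_add_tsum {s : ℂ} (hs : 0 < s.re) :
    riemannZeta₁ s = 1 + ∑' n, zetaOneTerm n s := by
  set a := s.re / 2 with ha
  have ha0 : 0 < a := by positivity
  set U : Set ℂ := {z | a < z.re} ∩ Metric.ball 0 (‖s‖ + a + 3) with hU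
  have hUo : IsOpen U := (isOpen_lt continuous_const Complex.continuous_re).inter Metric.isOpen_ball
  have hUc : IsPreconnected U :=
    ((convex_halfSpace_re_gt a).inter (convex_ball 0 _)).isPreconnected
  have hsum := (summable_one_div_add_one_rpow ha0).mul_left ((‖s‖ + a + 4) * (‖s‖ + a + 3))
  have hd : DifferentiableOn ℂ (fun z ↦ 1 + ∑' n, zetaOneTerm n z) U := by
    refine (differentiableOn_const 1).add (Complex.differentiableOn_tsum_of_summable_norm hsum
      (fun n ↦ (differentiable_zetaOneTerm n).differentiableOn) hUo fun n w hw ↦ ?_)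
    have h1 : ‖w‖ ≤ ‖s‖ + a + 3 := (mem_ball_zero_iff.1 hw.2).le
    have h2 : ‖w - 1‖ ≤ ‖s‖ + a + 4 := (norm_sub_le _ _).trans (by rw [norm_one]; linarith)
    exact (norm_zetaOneTerm_le n ha0.le (le_of_lt hw.1)).trans (by gcongr)
  have hmem : ((a + 2 : ℝ) : ℂ) ∈ U := by
    refine ⟨by simp, ?_⟩
    rw [mem_ball_zero_iff, Complex.norm_real, Real.norm_of_nonneg (by positivity)]
    linarith [norm_nonneg s]
  have hsU : s ∈ U := ⟨by simp only [Set.mem_ofPred_eq]; linarith, by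
    rw [mem_ball_zero_iff]; linarith⟩
  refine (differentiable_riemannZeta₁.differentiableOn.analyticOnNhd hUo)
    |>.eqOn_of_preconnected_of_eventuallyEq (hd.analyticOnNhd hUo) hUc hmem ?_ hsU
  have hnear : ∀ᶠ z : ℂ in 𝓝 ((a + 2 : ℝ) : ℂ), 1 < z.re :=
    Complex.continuous_re.continuousAt.eventually (lt_mem_nhds (by simp; linarith))
  filter_upwards [hnear] with z hz
  rw [(hasSum_zetaOneTerm hz).tsum_eq]
  ring

/-- Polynomial growth of `(s - 1) ζ(s)` in half-planes to the right of the imaginary axis. -/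
theorem norm_riemannZeta₁_le {a : ℝ} (ha : 0 < a) :
    ∃ C : ℝ, 1 ≤ C ∧ ∀ s : ℂ, a ≤ s.re → ‖riemannZeta₁ s‖ ≤ C * (1 + ‖s‖) ^ 2 := by
  have hsum := summable_one_div_add_one_rpow ha
  set S := ∑' n : ℕ, 1 / ((n : ℝ) + 1) ^ (a + 1)
  have hS : 0 ≤ S := tsum_nonneg fun n ↦ by positivity
  refine ⟨1 + S, by linarith, fun s hs ↦ ?_⟩
  rw [riemannZeta₁_eq_one_add_tsum (ha.trans_le hs)]
  have h1 : ‖∑' n, zetaOneTerm n s‖ ≤ ‖s - 1‖ * ‖s‖ * S := by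
    rw [← tsum_mul_left]
    exact tsum_of_norm_bounded (hsum.mul_left _).hasSum fun n ↦ norm_zetaOneTerm_le n ha.le hs
  have h2 : ‖s - 1‖ ≤ 1 + ‖s‖ := (norm_sub_le _ _).trans (by rw [norm_one, add_comm])
  have h3 : ‖s - 1‖ * ‖s‖ ≤ (1 + ‖s‖) ^ 2 := by nlinarith [norm_nonneg s, norm_nonneg (s - 1)]
  calc _ ≤ 1 + ‖s - 1‖ * ‖s‖ * S := (norm_add_le _ _).trans (by rw [norm_one]; gcongr)
    _ ≤ (1 + ‖s‖) ^ 2 + (1 + ‖s‖) ^ 2 * S := by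
        gcongr
        exact one_le_pow₀ (by linarith [norm_nonneg s])
    _ = _ := by ring

/-- A holomorphic function without zeros on a ball is bounded from below on smaller balls. -/
theorem norm_ge_of_forall_ball_ne_zero {f : ℂ → ℂ} {c w : ℂ} {R r L : ℝ}
    (hf : DifferentiableOn ℂ f (Metric.ball c R)) (hf0 : ∀ z ∈ Metric.ball c R, f z ≠ 0)
    (hL : 0 < L) (hfL : ∀ z ∈ Metric.ball c R, ‖f z‖ ≤ ‖f c‖ * Real.exp L)
    (hrR : r < R) (hw : ‖w - c‖ ≤ r) :
    ‖f c‖ * Real.exp (-(2 * L * r / (R - r))) ≤ ‖f w‖ := by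
  have hr : 0 ≤ r := (norm_nonneg _).trans hw
  have hR : 0 < R := hr.trans_lt hrR
  have hcm : c ∈ Metric.ball c R := Metric.mem_ball_self hR
  have hfc : f c ≠ 0 := hf0 c hcm
  have hlog : DifferentiableOn ℂ (fun z ↦ deriv f z / f z) (Metric.ball c R) :=
    (hf.deriv Metric.isOpen_ball).div hf hf0
  obtain ⟨g, hgc, hg⟩ := hlog.isExactOn_ball.with_val_at c 0
  have hd : ∀ z ∈ Metric.ball c R, HasDerivAt (fun z ↦ f z * Complex.exp (-g z)) 0 z := by
    intro z hz
    have h1 := (hf.differentiableAt (Metric.isOpen_ball.mem_nhds hz)).hasDerivAt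
    have h2 := h1.mul (hg z hz).neg.cexp
    convert! h2 using 1
    field_simp [hf0 z hz]
    simp
  have hconst : ∀ z ∈ Metric.ball c R, f z = f c * Complex.exp (g z) := by
    intro z hz
    have := Metric.isOpen_ball.is_const_of_deriv_eq_zero (convex_ball c R).isPreconnected
      (fun y hy ↦ (hd y hy).differentiableAt.differentiableWithinAt)
      (fun y hy ↦ (hd y hy).deriv) hz hcm
    simp only [hgc, neg_zero, Complex.exp_zero, mul_one] at this
    rw [← this, mul_assoc, ← Complex.exp_add, neg_add_cancel, Complex.exp_zero, mul_one]
  have hmem : ∀ z ∈ Metric.ball (0 : ℂ) R, z + c ∈ Metric.ball c R := by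
    intro z hz
    simpa [mem_ball_iff_norm] using hz
  have hBC := Complex.borelCaratheodory_zero (f := fun z ↦ g (z + c)) (z := w - c) (R := R) hL
    (fun z hz ↦ ((hg _ (hmem z hz)).comp_add_const z c).differentiableAt.differentiableWithinAt)
    (fun z hz ↦ by
      have h1 := hfL _ (hmem z hz)
      rw [hconst _ (hmem z hz), norm_mul, Complex.norm_exp] at h1
      exact Real.exp_le_exp.1 (le_of_mul_le_mul_left h1 (norm_pos_iff.2 hfc)))
    hR (by rw [mem_ball_zero_iff]; linarith) (by simpa using hgc)
  rw [sub_add_cancel] at hBC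
  have hwm : w ∈ Metric.ball c R := by rw [mem_ball_iff_norm]; linarith
  rw [hconst w hwm, norm_mul, Complex.norm_exp]
  gcongr
  have h3 : 2 * L * ‖w - c‖ / (R - ‖w - c‖) ≤ 2 * L * r / (R - r) := by
    have : 0 < R - r := by linarith
    gcongr
  have h4 := (abs_le.1 (Complex.abs_re_le_norm (g w))).1
  linarith

lemma norm_riemannZeta_sub_one_le {s : ℂ} (hs : 2 ≤ s.re) : ‖riemannZeta s - 1‖ ≤ 2 / 3 := by
  have hs1 : 1 < s.re := by linarith
  have hsum : Summable fun n : ℕ ↦ 1 / (n + 1 : ℂ) ^ s := by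
    have := (summable_nat_add_iff 1).2 (Complex.summable_one_div_nat_cpow.2 hs1)
    simpa using this
  have h2 := (hasSum_nat_add_iff' 2).2 hasSum_zeta_two
  rw [zeta_eq_tsum_one_div_nat_add_one_cpow hs1, hsum.tsum_eq_zero_add]
  simp only [Nat.cast_zero, zero_add, Complex.one_cpow, div_one, add_sub_cancel_left]
  refine (tsum_of_norm_bounded h2 fun n ↦ ?_).trans ?_
  · have := Complex.norm_cpow_eq_rpow_re_of_pos (x := (n : ℝ) + 2) (by positivity) s
    push_cast at this
    push_cast
    rw [add_assoc, one_add_one_eq_two, norm_div, norm_one, this]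
    gcongr
    rw [← Real.rpow_natCast]
    exact Real.rpow_le_rpow_of_exponent_le (by linarith [(Nat.cast_nonneg n : (0 : ℝ) ≤ n)])
      (by simpa using hs)
  · simp [Finset.sum_range_succ]
    nlinarith [Real.pi_lt_d2, Real.pi_pos]

lemma riemannZeta₁_ne_zero (hRH : RiemannHypothesis) {s : ℂ} (hs : 1 / 2 < s.re) :
    riemannZeta₁ s ≠ 0 := by
  intro h
  by_cases h1 : s = 1
  · simp [h1] at h
  have hz : riemannZeta s = 0 := by rw [riemannZeta_eq_inv_sub_mul h1, h, mul_zero]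
  have := hRH s hz (by
    rintro ⟨n, rfl⟩
    simp at hs
    linarith [(Nat.cast_nonneg n : (0 : ℝ) ≤ n)]) h1
  linarith

lemma riemannZeta₁_of_ne_one {s : ℂ} (hs : s ≠ 1) : riemannZeta₁ s = (s - 1) * riemannZeta s := by
  rw [riemannZeta_eq_inv_sub_mul hs, mul_inv_cancel_left₀ (sub_ne_zero.2 hs)]

lemma norm_riemannZeta₁_ge {s : ℂ} (hs : 2 ≤ s.re) : ‖s - 1‖ * (1 / 3) ≤ ‖riemannZeta₁ s‖ := by
  have hs1 : s ≠ 1 := by rintro rfl; norm_num at hs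
  rw [riemannZeta₁_of_ne_one hs1, norm_mul]
  gcongr
  have := norm_sub_norm_le (1 : ℂ) (1 - riemannZeta s)
  rw [norm_one, sub_sub_cancel, norm_sub_rev] at this
  linarith [norm_riemannZeta_sub_one_le hs]

lemma norm_riemannZeta₁_le_of_two_le_re {s : ℂ} (hs : 2 ≤ s.re) :
    ‖riemannZeta₁ s‖ ≤ ‖s - 1‖ * (5 / 3) := by
  have hs1 : s ≠ 1 := by rintro rfl; norm_num at hs
  rw [riemannZeta₁_of_ne_one hs1, norm_mul]
  gcongr
  have := norm_sub_norm_le (riemannZeta s) 1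
  rw [norm_one] at this
  linarith [norm_riemannZeta_sub_one_le hs]

lemma one_third_le_norm_riemannZeta₁ {s : ℂ} (hs : 2 ≤ s.re) : 1 / 3 ≤ ‖riemannZeta₁ s‖ := by
  have h1 : 1 ≤ ‖s - 1‖ := le_trans (by simp; linarith) (Complex.re_le_norm _)
  linarith [norm_riemannZeta₁_ge hs]

/-- Under the Riemann hypothesis, `1 / ((s - 1) ζ(s))` has finite order to the right of the
critical line. -/
theorem one_le_norm_riemannZeta₁_mul_exp (hRH : RiemannHypothesis) {η : ℝ} (hη : 0 < η) :
    ∃ B : ℝ, 0 < B ∧ ∀ s : ℂ, 1 / 2 + η ≤ s.re →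
      1 ≤ ‖riemannZeta₁ s‖ * Real.exp (B * (1 + ‖s‖)) := by
  obtain ⟨C, hC1, hC⟩ := norm_riemannZeta₁_le (a := 1 / 2) (by norm_num)
  have hB0 : 0 ≤ 6 * (3 * C + 6) / η := by positivity
  have h3 : Real.exp (-2) ≤ 1 / 3 := by
    rw [Real.exp_neg, one_div]
    gcongr
    linarith [Real.add_one_le_exp (2 : ℝ)]
  refine ⟨2 + 6 * (3 * C + 6) / η, by linarith, fun s hs ↦ ?_⟩
  suffices h : 1 / 3 * Real.exp (-(6 * (3 * C + 6) / η * (1 + ‖s‖))) ≤ ‖riemannZeta₁ s‖ by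
    have h5 : Real.exp (-((2 + 6 * (3 * C + 6) / η) * (1 + ‖s‖))) ≤ ‖riemannZeta₁ s‖ := by
      refine le_trans ?_ h
      refine le_trans ?_ (mul_le_mul_of_nonneg_right h3 (Real.exp_pos _).le)
      rw [← Real.exp_add]
      gcongr
      nlinarith [norm_nonneg s]
    calc (1 : ℝ) = Real.exp (-((2 + 6 * (3 * C + 6) / η) * (1 + ‖s‖))) *
          Real.exp ((2 + 6 * (3 * C + 6) / η) * (1 + ‖s‖)) := by
            rw [← Real.exp_add, neg_add_cancel, Real.exp_zero]
      _ ≤ _ := by gcongr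
  rcases le_or_gt 2 s.re with h2 | h2
  · refine le_trans ?_ (one_third_le_norm_riemannZeta₁ h2)
    refine mul_le_of_le_one_right (by norm_num) (Real.exp_le_one_iff.2 ?_)
    have : 0 ≤ 6 * (3 * C + 6) / η * (1 + ‖s‖) := by positivity
    linarith
  set c : ℂ := ⟨2, s.im⟩ with hc
  set L := (3 * C + 6) * (1 + ‖s‖) with hL
  have hL0 : 0 < L := by positivity
  have hsc : ‖s - c‖ ≤ 3 / 2 - η := by
    have : s - c = ((s.re - 2 : ℝ) : ℂ) := by
      apply Complex.ext <;> simp [hc]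
    rw [this, Complex.norm_real, Real.norm_eq_abs, abs_le]
    constructor <;> linarith
  have hcz : 1 / 3 ≤ ‖riemannZeta₁ c‖ := one_third_le_norm_riemannZeta₁ (by simp [hc])
  have hre : ∀ z ∈ Metric.ball c (3 / 2 - η / 2), 1 / 2 < z.re := by
    intro z hz
    rw [mem_ball_iff_norm] at hz
    have h1 := (abs_le.1 (Complex.abs_re_le_norm (z - c))).1
    simp [hc] at h1
    linarith
  have key := norm_ge_of_forall_ball_ne_zero (f := riemannZeta₁) (c := c) (w := s)
    (R := 3 / 2 - η / 2) (r := 3 / 2 - η) differentiable_riemannZeta₁.differentiableOn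
    (fun z hz ↦ riemannZeta₁_ne_zero hRH (hre z hz)) hL0 (fun z hz ↦ by
      have hzn : ‖z‖ ≤ ‖s‖ + 3 := by
        have e : z = s + ((z - c) - (s - c)) := by ring
        rw [mem_ball_iff_norm] at hz
        rw [e]
        refine (norm_add_le _ _).trans ?_
        linarith [norm_sub_le (z - c) (s - c)]
      have hx := norm_nonneg s
      have e1 : 3 * C ≤ Real.exp (3 * C) := by linarith [Real.add_one_le_exp (3 * C)]
      have e2 : 4 + ‖s‖ ≤ Real.exp (3 + ‖s‖) := by linarith [Real.add_one_le_exp (3 + ‖s‖)]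
      calc ‖riemannZeta₁ z‖ ≤ C * (1 + ‖z‖) ^ 2 := hC z (hre z hz).le
        _ ≤ C * (4 + ‖s‖) ^ 2 := by gcongr C * ?_ ^ 2; linarith
        _ = 1 / 3 * (3 * C * (4 + ‖s‖) ^ 2) := by ring
        _ ≤ 1 / 3 * (Real.exp (3 * C) * Real.exp (3 + ‖s‖) ^ 2) := by gcongr
        _ = 1 / 3 * Real.exp (3 * C + 2 * (3 + ‖s‖)) := by
            rw [← Real.exp_nat_mul, ← Real.exp_add]; norm_num
        _ ≤ ‖riemannZeta₁ c‖ * Real.exp L := by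
            gcongr
            rw [hL]
            nlinarith) (by linarith) hsc
  refine le_trans ?_ key
  gcongr
  rw [show 3 / 2 - η / 2 - (3 / 2 - η) = η / 2 by ring, div_mul_eq_mul_div, div_div_eq_mul_div]
  rw [div_le_div_iff_of_pos_right hη]
  nlinarith [mul_pos hL0 hη]

/-- The entire function `s (s - 1) π ^ (-s / 2) Γ(s / 2) ζ(s)`, on the right half-plane. -/
noncomputable def riemannXi (s : ℂ) : ℂ := s * riemannZeta₁ s * Complex.Gammaℝ s

lemma riemannXi_eq {s : ℂ} (h0 : s ≠ 0) (h1 : s ≠ 1) (hG : Complex.Gammaℝ s ≠ 0) :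
    riemannXi s = s * (s - 1) * completedRiemannZeta s := by
  rw [riemannXi, riemannZeta₁_of_ne_one h1, riemannZeta_def_of_ne_zero h0]
  field_simp

lemma Gammaℝ_conj (s : ℂ) :
    Complex.Gammaℝ ((starRingEnd ℂ) s) = (starRingEnd ℂ) (Complex.Gammaℝ s) := by
  have hpi : ((Real.pi : ℂ)).arg ≠ Real.pi := by
    rw [Complex.arg_ofReal_of_nonneg Real.pi_pos.le]
    exact Real.pi_pos.ne
  have h := Complex.cpow_conj (Real.pi : ℂ) (-s / 2) hpi
  rw [Complex.Gammaℝ_def, Complex.Gammaℝ_def, map_mul, ← Complex.Gamma_conj, map_div₀, map_ofNat]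
  congr 1
  rw [Complex.conj_ofReal, map_div₀, map_neg, map_ofNat] at h
  exact h

/-- The functional equation and the reflection principle, for the modulus. -/
lemma norm_riemannXi_one_sub_conj {s : ℂ} (h0 : 0 < s.re) (h1 : s.re < 1) :
    ‖riemannXi (1 - (starRingEnd ℂ) s)‖ = ‖riemannXi s‖ := by
  set t := (starRingEnd ℂ) s with ht
  have htre : t.re = s.re := Complex.conj_re s
  have hne : ∀ w : ℂ, 0 < w.re → w.re < 1 → w ≠ 0 ∧ w ≠ 1 := fun w h h' ↦
    ⟨by rintro rfl; simp at h, by rintro rfl; simp at h'⟩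
  obtain ⟨a1, a2⟩ := hne t (by linarith) (by linarith)
  obtain ⟨b1, b2⟩ := hne (1 - t) (by simp; linarith) (by simp; linarith)
  have hconj : riemannXi t = (starRingEnd ℂ) (riemannXi s) := by
    obtain ⟨c1, c2⟩ := hne s h0 h1
    rw [riemannXi, riemannXi, riemannZeta₁_of_ne_one a2, riemannZeta₁_of_ne_one c2, ht,
      riemannZeta_conj, Gammaℝ_conj]
    simp
  have hfe : riemannXi (1 - t) = riemannXi t := by
    rw [riemannXi_eq b1 b2 (Complex.Gammaℝ_ne_zero_of_re_pos (by simp; linarith)),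
      riemannXi_eq a1 a2 (Complex.Gammaℝ_ne_zero_of_re_pos (by linarith)),
      completedRiemannZeta_one_sub]
    ring
  rw [hfe, hconj, Complex.norm_conj]

lemma riemannXi_ne_zero (hRH : RiemannHypothesis) {s : ℂ} (hs : 1 / 2 < s.re) :
    riemannXi s ≠ 0 := by
  have h0 : 0 < s.re := by linarith
  refine mul_ne_zero (mul_ne_zero ?_ (riemannZeta₁_ne_zero hRH hs))
    (Complex.Gammaℝ_ne_zero_of_re_pos h0)
  rintro rfl
  simp at h0

lemma differentiableAt_riemannXi {s : ℂ} (hs : 0 < s.re) : DifferentiableAt ℂ riemannXi s := by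
  have hG : DifferentiableAt ℂ Complex.Gammaℝ s := by
    have := (Complex.differentiable_Gammaℝ_inv s).fun_inv
      (inv_ne_zero (Complex.Gammaℝ_ne_zero_of_re_pos hs))
    simpa using this
  exact (differentiableAt_id.mul (differentiable_riemannZeta₁ s)).mul hG

lemma norm_Gammaℝ_add (s : ℂ) (ε : ℝ) : ‖Complex.Gammaℝ (s + ε)‖ =
    Real.pi ^ (-(s.re + ε) / 2) * ‖Complex.Gamma (s / 2 + (ε / 2 : ℝ))‖ := by
  rw [Complex.Gammaℝ_def, norm_mul, Complex.norm_cpow_eq_rpow_re_of_pos Real.pi_pos]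
  congr 2
  · simp
  · push_cast; ring_nf

lemma norm_Gammaℝ (s : ℂ) : ‖Complex.Gammaℝ s‖ =
    Real.pi ^ (-s.re / 2) * ‖Complex.Gamma (s / 2)‖ := by
  simpa using norm_Gammaℝ_add s 0

lemma exists_norm_Gammaℝ_le {a ε : ℝ} (ha : 0 < a) (hε : 0 ≤ ε) : ∃ D : ℝ, 0 < D ∧
    ∀ s : ℂ, a ≤ s.re → ‖Complex.Gammaℝ s‖ ≤ D * ‖Complex.Gammaℝ (s + ε)‖ := by
  have g1 : 0 < Real.Gamma (a / 2) := Real.Gamma_pos_of_pos (by positivity)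
  have g2 : 0 < Real.Gamma (a / 2 + ε / 2) := Real.Gamma_pos_of_pos (by positivity)
  refine ⟨Real.pi ^ (ε / 2) * (Real.Gamma (a / 2) / Real.Gamma (a / 2 + ε / 2)), by positivity,
    fun s hs ↦ ?_⟩
  have h := norm_Gamma_mul_Gamma_add_le (a := a / 2) (δ := ε / 2) (z := s / 2) (by positivity)
    (by positivity) (by simpa using by linarith)
  rw [← le_div_iff₀ g2] at h
  rw [norm_Gammaℝ, norm_Gammaℝ_add]
  have e : Real.pi ^ (-s.re / 2) = Real.pi ^ (ε / 2) * Real.pi ^ (-(s.re + ε) / 2) := by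
    rw [← Real.rpow_add Real.pi_pos]; ring_nf
  rw [e]
  refine (mul_le_mul_of_nonneg_left h (by positivity)).trans_eq (by ring)

lemma norm_le_norm_add_ofReal {s : ℂ} {ε : ℝ} (hs : 0 ≤ s.re) (hε : 0 ≤ ε) : ‖s‖ ≤ ‖s + ε‖ := by
  refine le_of_sq_le_sq ?_ (norm_nonneg _)
  rw [Complex.sq_norm, Complex.sq_norm, Complex.normSq_apply, Complex.normSq_apply]
  simp
  nlinarith

/-- Under the Riemann hypothesis, `‖ξ‖` increases along horizontal shifts away from the
critical line. -/
theorem norm_riemannXi_le_add (hRH : RiemannHypothesis) {ε : ℝ} (hε : 0 < ε) (hε1 : ε ≤ 1 / 2)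
    {s : ℂ} (hs : (1 - ε) / 2 ≤ s.re) : ‖riemannXi s‖ ≤ ‖riemannXi (s + ε)‖ := by
  set a : ℝ := (1 - ε) / 2 with ha
  have ha4 : 1 / 4 ≤ a := by linarith
  have ha1 : a ≤ 1 := by linarith
  set f : ℂ → ℂ := fun z ↦ riemannXi (z + a) / riemannXi (z + a + ε) with hf
  obtain ⟨C, hC1, hC⟩ := norm_riemannZeta₁_le (a := 1 / 4) (by norm_num)
  obtain ⟨B, hB0, hB⟩ := one_le_norm_riemannZeta₁_mul_exp hRH (η := ε / 2) (by positivity)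
  obtain ⟨D, hD0, hD⟩ := exists_norm_Gammaℝ_le (a := 1 / 4) (by norm_num) hε.le
  have hfle : ∀ (w : ℂ) (M : ℝ), a ≤ w.re → 0 ≤ M →
      ‖riemannZeta₁ w‖ ≤ M * ‖riemannZeta₁ (w + ε)‖ →
      ‖riemannXi w / riemannXi (w + ε)‖ ≤ M * D := by
    intro w M hw hM h
    rw [norm_div, div_le_iff₀ (norm_pos_iff.2 (riemannXi_ne_zero hRH (by simp; linarith)))]
    simp only [riemannXi, norm_mul]
    calc _ ≤ ‖w + ε‖ * (M * ‖riemannZeta₁ (w + ε)‖) * (D * ‖Complex.Gammaℝ (w + ε)‖) := by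
          gcongr
          · exact norm_le_norm_add_ofReal (by linarith) hε.le
          · exact hD w (by linarith)
      _ = _ := by ring
  have hda : ∀ z : ℂ, 0 ≤ z.re → DifferentiableAt ℂ f z := by
    intro z hz
    have h1 : DifferentiableAt ℂ (fun z : ℂ ↦ riemannXi (z + a)) z :=
      (differentiableAt_riemannXi (s := z + a) (by simp; linarith)).comp z
        (f := fun z : ℂ ↦ z + a) (by fun_prop)
    have h2 : DifferentiableAt ℂ (fun z : ℂ ↦ riemannXi (z + a + ε)) z :=
      (differentiableAt_riemannXi (s := z + a + ε) (by simp; linarith)).comp z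
        (f := fun z : ℂ ↦ z + a + ε) (by fun_prop)
    exact h1.div h2 (riemannXi_ne_zero hRH (by simp; linarith))
  have hd : DiffContOnCl ℂ f {z | 0 < z.re} := by
    refine DifferentiableOn.diffContOnCl fun z hz ↦ (hda z ?_).differentiableWithinAt
    have : closure {z : ℂ | 0 < z.re} ⊆ {z : ℂ | 0 ≤ z.re} :=
      closure_minimal (fun z (hz : 0 < z.re) ↦ show 0 ≤ z.re from hz.le)
        (isClosed_le continuous_const Complex.continuous_re)
    exact this hz
  have hexp : ∃ c < (2 : ℝ), ∃ B', f =O[Bornology.cobounded ℂ ⊓ 𝓟 {z | 0 < z.re}]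
      fun z ↦ Real.exp (B' * ‖z‖ ^ c) := by
    refine ⟨1, one_lt_two, 2 + B, ?_⟩
    refine Asymptotics.IsBigO.of_bound (C * Real.exp (2 + 3 * B) * D) ?_
    refine eventually_inf_principal.2 (Eventually.of_forall fun z hz ↦ ?_)
    have hz' : 0 < z.re := hz
    set w := z + (a : ℂ) with hw
    have hwre : a ≤ w.re := by simp [hw]; linarith
    have hwn : ‖w‖ ≤ ‖z‖ + 1 := by
      refine (norm_add_le _ _).trans ?_
      rw [Complex.norm_real, Real.norm_of_nonneg (by linarith)]
      linarith
    have hwn' : ‖w + ε‖ ≤ ‖z‖ + 2 := by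
      refine (norm_add_le _ _).trans ?_
      rw [Complex.norm_real, Real.norm_of_nonneg hε.le]
      linarith
    have h1 := hB (w + ε) (by simp; linarith)
    have h2 : 1 + ‖w‖ ≤ Real.exp (1 + ‖z‖) := by linarith [Real.add_one_le_exp (1 + ‖z‖)]
    have h3 : ‖riemannZeta₁ w‖ ≤
        (C * Real.exp (2 + 3 * B + (2 + B) * ‖z‖)) * ‖riemannZeta₁ (w + ε)‖ := by
      calc ‖riemannZeta₁ w‖ ≤ C * (1 + ‖w‖) ^ 2 * 1 := by
            rw [mul_one]; exact hC w (by linarith)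
        _ ≤ C * Real.exp (1 + ‖z‖) ^ 2 *
            (‖riemannZeta₁ (w + ε)‖ * Real.exp (B * (1 + (‖z‖ + 2)))) := by
            gcongr
            refine h1.trans ?_
            gcongr
        _ = (C * (Real.exp (1 + ‖z‖) ^ 2 * Real.exp (B * (1 + (‖z‖ + 2))))) *
            ‖riemannZeta₁ (w + ε)‖ := by ring
        _ = _ := by
            rw [← Real.exp_nat_mul, ← Real.exp_add]
            congr 3
            push_cast; ring
    have h4 := hfle w _ hwre (by positivity) h3
    rw [Real.rpow_one, Real.norm_of_nonneg (Real.exp_pos _).le]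
    refine h4.trans_eq ?_
    rw [Real.exp_add (2 + 3 * B)]
    ring
  have hre : IsBoundedUnder (· ≤ ·) atTop fun x : ℝ ↦ ‖f x‖ := by
    refine isBoundedUnder_of_eventually_le (a := 5 * D) ?_
    filter_upwards [eventually_ge_atTop 2] with x hx
    set w := (x : ℂ) + (a : ℂ) with hw
    have hwre : w.re = x + a := by simp [hw]
    refine hfle w 5 (by linarith) (by norm_num) ?_
    have h1 := norm_riemannZeta₁_le_of_two_le_re (s := w) (by linarith)
    have h2 := norm_riemannZeta₁_ge (s := w + ε) (by simp; linarith)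
    have h3 := norm_le_norm_add_ofReal (s := w - 1) (ε := ε) (by simp; linarith) hε.le
    rw [sub_add_eq_add_sub] at h3
    linarith
  have him : ∀ x : ℝ, ‖f (x * Complex.I)‖ ≤ 1 := by
    intro x
    have h := norm_riemannXi_one_sub_conj (s := x * Complex.I + a) (by simp; linarith)
      (by simp; linarith)
    have e : 1 - (starRingEnd ℂ) (x * Complex.I + a) = x * Complex.I + a + ε := by
      apply Complex.ext <;> simp
      linarith
    rw [e] at h
    simp only [hf, norm_div, h]
    exact div_self_le_one _
  have := PhragmenLindelof.right_half_plane_of_bounded_on_real hd hexp hre him (z := s - a)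
    (by simpa using hs)
  simp only [hf, sub_add_cancel, norm_div] at this
  exact (div_le_one (norm_pos_iff.2 (riemannXi_ne_zero hRH (by simp; linarith)))).1 this

/-- Under the Riemann hypothesis, `ζ(s) / ζ(s + ε)` is bounded by its Gamma factor. -/
theorem norm_zetaQuotient_mul_le (hRH : RiemannHypothesis) : ∃ K : ℝ, 1 ≤ K ∧ ∀ ε : ℝ, 0 < ε →
    ε ≤ 1 / 2 → ∀ s : ℂ, 1 / 2 ≤ s.re → s ≠ 1 →
      ‖zetaQuotient ε s‖ * (‖s‖ * ‖s - 1‖) ≤ ‖s + ε‖ * ‖s + ε - 1‖ * (K * ‖s‖) ^ (ε / 2) := by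
  obtain ⟨K, hK0, hK⟩ := norm_Gamma_add_le (a := 1 / 4) (by norm_num)
  refine ⟨max K 1, le_max_right _ _, fun ε hε hε1 s hs hs1 ↦ ?_⟩
  rw [zetaQuotient]
  split_ifs with h
  · rw [norm_zero, zero_mul]
    positivity
  have hre : 1 / 2 < (s + ε).re := by simp; linarith
  have hxi := norm_riemannXi_le_add hRH hε hε1 (s := s) (by linarith)
  have hζ : riemannZeta (s + ε) ≠ 0 := fun h0 ↦ by
    have := riemannZeta₁_ne_zero hRH hre
    rw [riemannZeta₁_of_ne_one h, h0, mul_zero] at this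
    exact this rfl
  simp only [riemannXi, riemannZeta₁_of_ne_one h, riemannZeta₁_of_ne_one hs1, norm_mul] at hxi
  have hGs : 0 < ‖Complex.Gammaℝ s‖ :=
    norm_pos_iff.2 (Complex.Gammaℝ_ne_zero_of_re_pos (by linarith))
  have hG : ‖Complex.Gammaℝ (s + ε)‖ ≤ (max K 1 * ‖s‖) ^ (ε / 2) * ‖Complex.Gammaℝ s‖ := by
    have h1 := hK (s / 2) (ε / 2) (by positivity) (by linarith) (by simpa using by linarith)
    have h2 : Real.pi ^ (-(s.re + ε) / 2) ≤ Real.pi ^ (-s.re / 2) :=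
      Real.rpow_le_rpow_of_exponent_le (by linarith [Real.pi_gt_three]) (by linarith)
    rw [norm_Gammaℝ_add, norm_Gammaℝ s]
    calc _ ≤ Real.pi ^ (-s.re / 2) *
          ((max K 1 * ‖s‖) ^ (ε / 2) * ‖Complex.Gamma (s / 2)‖) := by
          gcongr
          refine h1.trans ?_
          gcongr
          · exact le_max_left _ _
          · rw [norm_div, Complex.norm_ofNat]
            linarith [norm_nonneg s]
      _ = _ := by ring
  rw [norm_div, div_mul_eq_mul_div, div_le_iff₀ (norm_pos_iff.2 hζ)]
  refine le_of_mul_le_mul_right ?_ hGs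
  calc _ = ‖s‖ * (‖s - 1‖ * ‖riemannZeta s‖) * ‖Complex.Gammaℝ s‖ := by ring
    _ ≤ _ := hxi
    _ ≤ ‖s + ε‖ * (‖s + ε - 1‖ * ‖riemannZeta (s + ε)‖) *
        ((max K 1 * ‖s‖) ^ (ε / 2) * ‖Complex.Gammaℝ s‖) := by gcongr
    _ = _ := by ring

theorem sq_norm_zetaQuotient_le (hRH : RiemannHypothesis) : ∃ K : ℝ, 1 ≤ K ∧ ∀ ε : ℝ, 0 < ε →
    ε ≤ 1 / 2 → ∀ s : ℂ, s.re = 1 / 2 → ‖zetaQuotient ε s‖ ^ 2 ≤ (K * ‖s‖) ^ ε := by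
  obtain ⟨K, hK1, hK⟩ := norm_zetaQuotient_mul_le hRH
  refine ⟨Real.exp 4 * K, one_le_mul_of_one_le_of_one_le (Real.one_le_exp (by norm_num)) hK1,
    fun ε hε hε1 s hs ↦ ?_⟩
  have h := hK ε hε hε1 s hs.ge (by rintro rfl; norm_num at hs)
  set A := s.im ^ 2 + 1 / 4 with hA
  have hA4 : 1 / 4 ≤ A := by nlinarith [sq_nonneg s.im]
  have e1 : ‖s‖ ^ 2 = A := by
    rw [Complex.sq_norm, Complex.normSq_apply, hs, hA]; ring
  have e2 : ‖s - 1‖ ^ 2 = A := by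
    rw [Complex.sq_norm, Complex.normSq_apply, hA]; simp [hs]; ring
  have e3 : ‖s + ε‖ ^ 2 = A + ε ^ 2 + ε := by
    rw [Complex.sq_norm, Complex.normSq_apply, hA]; simp [hs]; ring
  have e4 : ‖s + ε - 1‖ ^ 2 = A + ε ^ 2 - ε := by
    rw [Complex.sq_norm, Complex.normSq_apply, hA]; simp [hs]; ring
  have hx : 0 ≤ K * ‖s‖ := by positivity
  have e5 : ((K * ‖s‖) ^ (ε / 2)) ^ 2 = (K * ‖s‖) ^ ε := by
    rw [← Real.rpow_natCast, ← Real.rpow_mul hx]; congr 1; push_cast; ring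
  have hsq := pow_le_pow_left₀ (by positivity) h 2
  rw [mul_pow, mul_pow, mul_pow, mul_pow, e1, e2, e3, e4, e5] at hsq
  have hexp : (A + ε ^ 2 + ε) * (A + ε ^ 2 - ε) ≤ Real.exp (4 * ε) * (A * A) := by
    have h1 : (A + ε ^ 2 + ε) * (A + ε ^ 2 - ε) ≤ (4 * ε + 1) * (A * A) := by
      have h2 : ε ^ 2 * (2 * A) ≤ ε ^ 2 * (8 * (A * A)) :=
        mul_le_mul_of_nonneg_left (by nlinarith) (sq_nonneg ε)
      have h3 : ε ^ 2 * (8 * (A * A)) ≤ 4 * ε * (A * A) := by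
        have : ε ^ 2 * 8 ≤ 4 * ε := by nlinarith
        nlinarith [mul_le_mul_of_nonneg_right this (mul_self_nonneg A)]
      have h4 : ε ^ 2 * ε ^ 2 ≤ ε ^ 2 := mul_le_of_le_one_right (sq_nonneg _) (by nlinarith)
      nlinarith
    exact h1.trans (by gcongr; exact Real.add_one_le_exp _)
  have hAA : 0 < A * A := by positivity
  refine le_of_mul_le_mul_right ?_ hAA
  rw [mul_assoc (Real.exp 4), Real.mul_rpow (Real.exp_pos _).le hx, ← Real.exp_mul]
  calc _ ≤ _ := hsq
    _ ≤ Real.exp (4 * ε) * (A * A) * (K * ‖s‖) ^ ε := by gcongr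
    _ = _ := by ring

theorem proposition4 (hRH : RiemannHypothesis) :
    (∃ C : ℝ, 0 < C ∧ ∀ ε : ℝ, 0 < ε → ε ≤ 1 / 2 → ∀ s : ℂ, s.re = 1 / 2 →
      ‖zetaQuotient ε s‖ ^ 2 ≤ C * ‖s‖ ^ ε) ∧
    (∃ C : ℝ, 0 < C ∧ ∀ ε : ℝ, 0 < ε → ε ≤ 1 / 2 → ∀ s : ℂ, s.re = 1 / 2 →
      ‖zetaQuotient ε s‖ ^ 2 ≤ 1 + C * (ε * ‖s‖ ^ (1 / 2 : ℝ))) ∧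
    (∃ C : ℝ, 0 < C ∧ ∀ ε : ℝ, 0 < ε → ε ≤ 1 / 2 → ∀ s : ℂ, 1 / 2 ≤ s.re → s ≠ 1 →
      ‖zetaQuotient ε s / (s * (1 - s))‖ ≤ C * (‖s‖ ^ (ε / 2) / ‖s - 1‖ ^ 2)) := by
  have hKpow : ∀ K x : ℝ, 1 ≤ K → 0 ≤ x → ∀ r : ℝ, r ≤ 1 → (K * x) ^ r ≤ K * x ^ r := by
    intro K x hK hx r hr
    rw [Real.mul_rpow (by linarith) hx]
    gcongr
    exact (Real.rpow_le_rpow_of_exponent_le hK hr).trans_eq (Real.rpow_one K)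
  obtain ⟨K, hK1, hK⟩ := sq_norm_zetaQuotient_le hRH
  refine ⟨⟨K, by linarith, fun ε hε hε1 s hs ↦ ?_⟩,
    ⟨2 * K, by linarith, fun ε hε hε1 s hs ↦ ?_⟩, ?_⟩
  · exact (hK ε hε hε1 s hs).trans (hKpow K _ hK1 (norm_nonneg s) ε (by linarith))
  · refine (hK ε hε hε1 s hs).trans ?_
    have hx : 0 ≤ K * ‖s‖ := by positivity
    have amgm := Real.geom_mean_le_arith_mean2_weighted (w₁ := 1 - 2 * ε) (w₂ := 2 * ε)
      (p₁ := 1) (p₂ := (K * ‖s‖) ^ (1 / 2 : ℝ)) (by linarith) (by linarith) zero_le_one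
      (by positivity) (by ring)
    rw [Real.one_rpow, one_mul, ← Real.rpow_mul hx, show 1 / 2 * (2 * ε) = ε by ring] at amgm
    have h2 := mul_le_mul_of_nonneg_left
      (hKpow K _ hK1 (norm_nonneg s) (1 / 2) (by norm_num)) hε.le
    linarith
  · obtain ⟨K, hK1, hK⟩ := norm_zetaQuotient_mul_le hRH
    refine ⟨6 * K, by linarith, fun ε hε hε1 s hs hs1 ↦ ?_⟩
    have hs2 : 1 / 2 ≤ ‖s‖ := hs.trans (Complex.re_le_norm s)
    have hs0 : 0 < ‖s‖ := by linarith
    have hs3 : 0 < ‖s - 1‖ := norm_pos_iff.2 (sub_ne_zero.2 hs1)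
    have h1 : ‖s + ε‖ ≤ 2 * ‖s‖ := by
      refine (norm_add_le _ _).trans ?_
      rw [Complex.norm_real, Real.norm_of_nonneg hε.le]
      linarith
    have h2 : ‖s + ε - 1‖ ≤ 3 * ‖s‖ := by
      have e : s + ε - 1 = s - ((1 - ε : ℝ) : ℂ) := by push_cast; ring
      rw [e]
      refine (norm_sub_le _ _).trans ?_
      rw [Complex.norm_real, Real.norm_of_nonneg (by linarith)]
      linarith
    have h3 : ‖zetaQuotient ε s‖ * (‖s‖ * ‖s - 1‖) ≤
        2 * ‖s‖ * (3 * ‖s‖) * (K * ‖s‖ ^ (ε / 2)) := by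
      refine (hK ε hε hε1 s hs hs1).trans ?_
      gcongr
      exact hKpow K _ hK1 hs0.le _ (by linarith)
    rw [norm_div, norm_mul, norm_sub_rev 1 s, mul_div_assoc', div_le_div_iff₀ (by positivity)
      (by positivity)]
    refine le_of_mul_le_mul_left ?_ hs0
    calc _ = ‖zetaQuotient ε s‖ * (‖s‖ * ‖s - 1‖) * ‖s - 1‖ := by ring
      _ ≤ 2 * ‖s‖ * (3 * ‖s‖) * (K * ‖s‖ ^ (ε / 2)) * ‖s - 1‖ := by gcongr
      _ = _ := by ring
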